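/- Let $k$ be a field. Call an object $S$ of an abelian $k$-linear category simple if it is a simple object and $\operatorname{End}(S)=k\cdot\mathrm{id}_S\cong k$. A semisimple $k$-linear monoidal category is a monoidal category which is abelian and $k$-linear with finite-dimensional morphism spaces, in which every object is a (finite) direct sum of simple objects, the tensor product is $k$-bilinear, and the unit object $I$ is simple. A dual of $V$ is an object $V^\vee$ with morphisms $\mathrm{ev}\colon V^\vee\otimes V\to I$ and $\mathrm{db}\colon I\to V\otimes V^\vee$ satisfying the triangle identities. A pivotal structure is, for a choice of a dual for every object, an isomorphism $j\colon V\to V^{\vee\vee}$ of monoidal functors. Associativity and unit isomorphisms are understood below. Put $V^{\otimes 0}=I$, $V^{\otimes (n+1)}=V\otimes V^{\otimes n}$. For objects $V,W$ let $E_{V,W}\colon \mathcal C(I,V\otimes W)\to\mathcal C(I,W\otimes V)$ be the composition $$\mathcal C(I,V\otimes W)\xrightarrow{A}\mathcal C(V^\vee,W)\xrightarrow{T}\mathcal C(W^\vee,V)\xrightarrow{A^{-1}}\mathcal C(I,W\otimes V),$$ where $A(f)=(\mathrm{ev}\otimes W)(V^\vee\otimes f)$ is the duality adjunction and $T(f)=j_V^{-1}f^\vee$.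 For $n\ge 1$ let $E_V^{(n)}$ be the endomorphism of $\mathcal C(I,V^{\otimes n})$ given by $E_{V,V^{\otimes(n-1)}}$ followed by the canonical isomorphism $V^{\otimes (n-1)}\otimes V\cong V^{\otimes n}$, and put $\nu_n(V)=\operatorname{Tr}(E_V^{(n)})\in k$. A trivial object is a finite direct sum of copies of $I$. For $V$ arbitrary and $T$ trivial let $\tau_{V,T}\colon V\otimes T\to T\otimes V$ be the unique isomorphism natural in $V$ and $T$ such that $\tau_{V,I}$ is the canonical isomorphism. A trivial component of an object $U$ is a triple $(U^{\mathrm{triv}},\iota\colon U^{\mathrm{triv}}\to U,\pi\colon U\to U^{\mathrm{triv}})$ with $U^{\mathrm{triv}}$ trivial which is the part belonging to $I$ in a decomposition of $U$ into isotypical components. Given a right dual $X$ of $V^{\otimes(n-1)}$ (with morphisms $\mathrm{db}\colon I\to X\otimes V^{\otimes(n-1)}$ and $\mathrm{ev}\colon V^{\otimes(n-1)}\otimes X\to I$ satisfying the triangle identities) and a trivial component of $V^{\otimes n}$, the $n$-th Frobenius–Schur endomorphism of $V$ is $$\mathrm{FS}_V^{(n)}=\Bigl(V\xrightarrow{\mathrm{db}\otimes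 V}X\otimes V^{\otimes (n-1)}\otimes V\cong X\otimes V^{\otimes n}\xrightarrow{X\otimes\pi}X\otimes (V^{\otimes n})^{\mathrm{triv}}\xrightarrow{\tau}(V^{\otimes n})^{\mathrm{triv}}\otimes X\xrightarrow{\iota\otimes X}V\otimes V^{\otimes(n-1)}\otimes X\xrightarrow{V\otimes\mathrm{ev}}V\Bigr).$$ The left and right pivotal traces of $f\colon V\to V$ are the endomorphisms of $I$ $$\operatorname{ptr}^\ell(f)=\mathrm{ev}_V\,(V^\vee\otimes f)\,(V^\vee\otimes j_V^{-1})\,\mathrm{db}_{V^\vee},\qquad \operatorname{ptr}^r(f)=\mathrm{ev}_{V^\vee}\,(j_V\otimes V^\vee)\,(f\otimes V^\vee)\,\mathrm{db}_V,$$ and the category is spherical if $\operatorname{ptr}^\ell(f)=\operatorname{ptr}^r(f)$ for all endomorphisms $f$. **Theorem.** Let $\mathcal C$ be a semisimple $k$-linear monoidal category with a pivotal structure, $V$ an object of $\mathcal C$ and $n\ge1$. Then a right dual of $V^{\otimes(n-1)}$ and a trivial component of $V^{\otimes n}$ exist, and for every choice of them $$\operatorname{ptr}^\ell\bigl(\mathrm{FS}_V^{(n)}\bigr)=\nu_n(V)\cdot\mathrm{id}_I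 .$$ If in addition $\mathcal C$ is spherical, then $\nu_n(V)=\nu_n(V^\vee)$. -/

import Mathlib

open CategoryTheory MonoidalCategory Limits

universe w v u

namespace FrobeniusSchur

noncomputable section

attribute [local instance] Abelian.hasFiniteBiproducts

/-! ### Semisimple linear monoidal categories -/

section Semisimple

variable (k : Type w) [Field k] {C : Type u} [Category.{v} C] [Abelian C] [Linear k C]

/-- Simple objects of a `k`-linear abelian category, in the absolute sense: simple objects whose
endomorphism algebra is reduced to the scalars `k`. -/
def IsSimpleObj (S : C) : Prop :=
  Simple S ∧ Function.Bijective (fun c : k => c • 𝟙 S)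

/-- `X` is `S`-isotypical: it is isomorphic to a (finite, possibly empty) direct sum of copies
of `S`. -/
def IsIsotypical (S X : C) : Prop :=
  ∃ m : ℕ, Nonempty (X ≅ ⨁ fun _ : Fin m => S)

/-- A semisimple `k`-linear category: an abelian `k`-linear category with finite dimensional
morphism spaces in which every object is a direct sum of simple objects. -/
class IsSemisimpleCat (C : Type u) [Category.{v} C] [Abelian C] [Linear k C] : Prop where
  finiteDimensional : ∀ X Y : C, FiniteDimensional k (X ⟶ Y)
  exists_decomposition : ∀ X : C, ∃ (m : ℕ) (S : Fin m → C),
    (∀ a, IsSimpleObj k (S a)) ∧ Nonempty (X ≅ ⨁ S)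

/-- A semisimple `k`-linear monoidal category: the underlying category is semisimple, the tensor
product is `k`-bilinear (this is expressed by the classes `MonoidalPreadditive` and
`MonoidalLinear`), and the unit object is simple. -/
class IsSemisimpleMonoidalCat (C : Type u) [Category.{v} C] [Abelian C] [Linear k C]
    [MonoidalCategory C] [MonoidalPreadditive C] [MonoidalLinear k C] : Prop extends
    IsSemisimpleCat k C where
  simple_unit : IsSimpleObj k (𝟙_ C)

/-- An isotypical component `(V^(S), ι, π)` of `V` belonging to the simple object `S`: it can be
completed, by isotypical objects belonging to pairwise non-isomorphic simple objects which are not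
isomorphic to `S`, to a direct sum decomposition of `V`. -/
structure IsotypicalComponent (S V : C) where
  /-- the isotypical component -/
  obj : C
  /-- the inclusion -/
  ι : obj ⟶ V
  /-- the projection -/
  π : V ⟶ obj
  isotypical : IsIsotypical S obj
  ι_π : ι ≫ π = 𝟙 obj
  exists_complement : ∃ (m : ℕ) (R : Fin m → C) (Y : Fin m → C)
    (i : ∀ a, Y a ⟶ V) (p : ∀ a, V ⟶ Y a),
    (∀ a, IsSimpleObj k (R a)) ∧
    (∀ a, IsEmpty (R a ≅ S)) ∧
    (∀ a b, Nonempty (R a ≅ R b) → a = b) ∧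
    (∀ a, IsIsotypical (R a) (Y a)) ∧
    (∀ a, i a ≫ p a = 𝟙 (Y a)) ∧
    π ≫ ι + ∑ a, p a ≫ i a = 𝟙 V

end Semisimple

/-! ### Trivial objects and their canonical commutation with arbitrary objects -/

section Trivial

/-- Trivial objects are the isotypical objects belonging to the unit object. -/
def IsTrivialObj {C : Type u} [Category.{v} C] [Abelian C] [MonoidalCategory C] (T : C) : Prop :=
  IsIsotypical (𝟙_ C) T

/-- Natural isomorphisms `V ⊗ T ≅ T ⊗ V`, for `T` trivial and `V` arbitrary, which for `T` the unit
object are the canonical isomorphism. -/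
@[ext] structure TrivialBraiding (C : Type u) [Category.{v} C] [Abelian C] [MonoidalCategory C] where
  /-- the isomorphisms -/
  τ : ∀ V T : C, IsTrivialObj T → (V ⊗ T ≅ T ⊗ V)
  naturality : ∀ {V V' T T' : C} (hT : IsTrivialObj T) (hT' : IsTrivialObj T')
    (f : V ⟶ V') (g : T ⟶ T'),
    (f ⊗ₘ g) ≫ (τ V' T' hT').hom = (τ V T hT).hom ≫ (g ⊗ₘ f)
  unit : ∀ (V : C) (h : IsTrivialObj (𝟙_ C)), (τ V (𝟙_ C) h).hom = (ρ_ V).hom ≫ (λ_ V).inv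

section
variable {C : Type u} [Category.{v} C] [Abelian C] [MonoidalCategory C]

lemma IsTrivialObj.exists_data {T : C} (h : IsTrivialObj T) :
    ∃ (m : ℕ) (p : Fin m → (T ⟶ 𝟙_ C)) (q : Fin m → (𝟙_ C ⟶ T)),
      (∀ a b, q a ≫ p b = if a = b then 𝟙 (𝟙_ C) else 0) ∧ ∑ a, p a ≫ q a = 𝟙 T := by
  obtain ⟨m, ⟨e⟩⟩ := h
  refine ⟨m, fun a => e.hom ≫ biproduct.π _ a, fun a => biproduct.ι (fun _ : Fin m => 𝟙_ C) a ≫ e.inv, ?_, ?_⟩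
  · intro a b
    simp [biproduct.ι_π]
  · have h1 : ∀ a : Fin m, (e.hom ≫ biproduct.π (fun _ : Fin m => 𝟙_ C) a) ≫
        biproduct.ι (fun _ : Fin m => 𝟙_ C) a ≫ e.inv =
        e.hom ≫ (biproduct.π (fun _ : Fin m => 𝟙_ C) a ≫
          biproduct.ι (fun _ : Fin m => 𝟙_ C) a) ≫ e.inv := by
      intro a; simp
    simp only [h1, ← Preadditive.comp_sum, ← Preadditive.sum_comp, biproduct.total]
    simp

lemma isTrivialObj_unit : IsTrivialObj (𝟙_ C) :=
  ⟨1, ⟨(biproductUniqueIso (fun _ : Fin 1 => 𝟙_ C)).symm⟩⟩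

end

lemma unit_slide (k : Type w) [Field k] {C : Type u} [Category.{v} C] [Abelian C] [Linear k C]
    [MonoidalCategory C] [MonoidalPreadditive C] [MonoidalLinear k C]
    [IsSemisimpleMonoidalCat k C] (V : C) (a : 𝟙_ C ⟶ 𝟙_ C) :
    V ◁ a ≫ (ρ_ V).hom ≫ (λ_ V).inv = (ρ_ V).hom ≫ (λ_ V).inv ≫ a ▷ V := by
  obtain ⟨c, hc⟩ := (IsSemisimpleMonoidalCat.simple_unit (k := k) (C := C)).2.2 a
  subst hc
  simp [MonoidalLinear.whiskerLeft_smul, MonoidalLinear.smul_whiskerRight]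

/-- Both the existence and the uniqueness of the canonical natural isomorphism. -/
theorem existsUnique_trivialBraiding (k : Type w) [Field k] (C : Type u) [Category.{v} C]
    [Abelian C] [Linear k C] [MonoidalCategory C] [MonoidalPreadditive C] [MonoidalLinear k C]
    [IsSemisimpleMonoidalCat k C] :
    ∃! _t : TrivialBraiding C, True := by
  choose m p q hqp hpq using fun (T : C) (h : IsTrivialObj T) => h.exists_data
  let th (V T : C) (h : IsTrivialObj T) : V ⊗ T ⟶ T ⊗ V :=
    ∑ a, V ◁ p T h a ≫ (ρ_ V).hom ≫ (λ_ V).inv ≫ q T h a ▷ V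
  have hq : ∀ (V T : C) (h : IsTrivialObj T) (a : Fin (m T h)),
      V ◁ q T h a ≫ th V T h = (ρ_ V).hom ≫ (λ_ V).inv ≫ q T h a ▷ V := by
    intro V T h a
    simp only [th, Preadditive.comp_sum, ← MonoidalCategory.whiskerLeft_comp_assoc, hqp]
    rw [Finset.sum_eq_single a]
    · simp
    · intro b _ hb
      simp [hb.symm]
    · simp
  -- two morphisms out of `V ⊗ T` agree if they agree on all `V ◁ q`
  have ext1 : ∀ (V T : C) (h : IsTrivialObj T) {Z : C} (f g : V ⊗ T ⟶ Z),
      (∀ a, V ◁ q T h a ≫ f = V ◁ q T h a ≫ g) → f = g := by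
    intro V T h Z f g hfg
    have e : ∀ f : V ⊗ T ⟶ Z, f = ∑ a, V ◁ p T h a ≫ V ◁ q T h a ≫ f := by
      intro f
      simp only [← MonoidalCategory.whiskerLeft_comp_assoc, ← Preadditive.sum_comp,
        ← whiskerLeft_sum, hpq]
      simp
    rw [e f, e g]
    simp only [hfg]
  have ext2 : ∀ (V T : C) (h : IsTrivialObj T) {Z : C} (f g : T ⊗ V ⟶ Z),
      (∀ a, q T h a ▷ V ≫ f = q T h a ▷ V ≫ g) → f = g := by
    intro V T h Z f g hfg
    have e : ∀ f : T ⊗ V ⟶ Z, f = ∑ a, p T h a ▷ V ≫ q T h a ▷ V ≫ f := by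
      intro f
      simp only [← MonoidalCategory.comp_whiskerRight_assoc, ← Preadditive.sum_comp,
        ← sum_whiskerRight, hpq]
      simp
    rw [e f, e g]
    simp only [hfg]
  let ti (V T : C) (h : IsTrivialObj T) : T ⊗ V ⟶ V ⊗ T :=
    ∑ a, p T h a ▷ V ≫ (λ_ V).hom ≫ (ρ_ V).inv ≫ V ◁ q T h a
  have hi : ∀ (V T : C) (h : IsTrivialObj T) (a : Fin (m T h)),
      q T h a ▷ V ≫ ti V T h = (λ_ V).hom ≫ (ρ_ V).inv ≫ V ◁ q T h a := by
    intro V T h a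
    simp only [ti, Preadditive.comp_sum, ← MonoidalCategory.comp_whiskerRight_assoc, hqp]
    rw [Finset.sum_eq_single a]
    · simp
    · intro b _ hb
      simp [hb.symm]
    · simp
  -- naturality with respect to morphisms `𝟙_ C ⟶ T`
  have hu : ∀ (V T : C) (h : IsTrivialObj T) (g : 𝟙_ C ⟶ T),
      V ◁ g ≫ th V T h = (ρ_ V).hom ≫ (λ_ V).inv ≫ g ▷ V := by
    intro V T h g
    have e : ∀ a, V ◁ g ≫ V ◁ p T h a ≫ (ρ_ V).hom ≫ (λ_ V).inv ≫ q T h a ▷ V =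
        (ρ_ V).hom ≫ (λ_ V).inv ≫ (g ≫ p T h a ≫ q T h a) ▷ V := by
      intro a
      have := unit_slide k V (g ≫ p T h a)
      rw [MonoidalCategory.whiskerLeft_comp, Category.assoc] at this
      rw [← Category.assoc g, comp_whiskerRight, reassoc_of% this]
    simp only [th, Preadditive.comp_sum, e]
    simp only [← Preadditive.comp_sum, ← sum_whiskerRight, hpq]
    simp
  let t : TrivialBraiding C :=
    { τ := fun V T h =>
        { hom := th V T h
          inv := ti V T h
          hom_inv_id := by
            apply ext1 V T h
            intro a
            rw [reassoc_of% (hq V T h a), hi]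
            simp
          inv_hom_id := by
            apply ext2 V T h
            intro a
            rw [reassoc_of% (hi V T h a), hq]
            simp }
      naturality := by
        intro V V' T T' hT hT' f g
        apply ext1 V T hT
        intro a
        rw [reassoc_of% (hq V T hT a)]
        simp only [MonoidalCategory.tensorHom_def', Category.assoc]
        rw [← MonoidalCategory.whiskerLeft_comp_assoc,
          MonoidalCategory.whisker_exchange_assoc, hu]
        simp only [comp_whiskerRight]
        rw [← MonoidalCategory.whisker_exchange_assoc]
        simp
      unit := by
        intro V h
        simpa using hu V (𝟙_ C) h (𝟙 _) }
  refine ⟨t, trivial, ?_⟩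
  intro s _
  have key : ∀ V T h, (s.τ V T h).hom = (t.τ V T h).hom := by
    intro V T h
    apply ext1 V T h
    intro a
    have h1 := s.naturality isTrivialObj_unit h (𝟙 V) (q T h a)
    have h2 := t.naturality isTrivialObj_unit h (𝟙 V) (q T h a)
    rw [s.unit] at h1
    rw [t.unit] at h2
    simp only [id_tensorHom, tensorHom_id] at h1 h2
    rw [h1, h2]
  have key' : s.τ = t.τ := by
    funext V T h
    exact Iso.ext (key V T h)
  exact TrivialBraiding.ext key'

/-- The canonical natural isomorphism `V ⊗ T ≅ T ⊗ V` for trivial objects `T`. -/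
def trivialBraiding (k : Type w) [Field k] (C : Type u) [Category.{v} C]
    [Abelian C] [Linear k C] [MonoidalCategory C] [MonoidalPreadditive C] [MonoidalLinear k C]
    [IsSemisimpleMonoidalCat k C] :
    TrivialBraiding C :=
  (existsUnique_trivialBraiding k C).choose

end Trivial

/-! ### Duality and pivotal structures -/

section Pivotal

variable {C : Type u} [Category.{v} C] [MonoidalCategory C] [RightRigidCategory C]

/-- The chosen (left) dual `V^∨` of `V`, with morphisms `V^∨ ⊗ V ⟶ 𝟙_ C` and
`𝟙_ C ⟶ V ⊗ V^∨`. (Mathlib calls this a right dual.) -/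
abbrev dual (V : C) : C := HasRightDual.rightDual V

/-- The evaluation `V^∨ ⊗ V ⟶ 𝟙_ C`. -/
abbrev ev (V : C) : dual V ⊗ V ⟶ 𝟙_ C := ε_ V (dual V)

/-- The coevaluation `𝟙_ C ⟶ V ⊗ V^∨`. -/
abbrev db (V : C) : 𝟙_ C ⟶ V ⊗ dual V := η_ V (dual V)

/-- The dual (transpose) `f^∨ : W^∨ ⟶ V^∨` of `f : V ⟶ W`. -/
abbrev dualMap {V W : C} (f : V ⟶ W) : dual W ⟶ dual V := rightAdjointMate f

variable (C) in
/-- The bidual functor `V ↦ V^∨∨`. -/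
def bidual : C ⥤ C where
  obj V := dual (dual V)
  map f := dualMap (dualMap f)
  map_id V := by simp [dualMap]
  map_comp f g := by simp only [dualMap, comp_rightAdjointMate]

/-- The canonical isomorphism `W^∨ ⊗ V^∨ ≅ (V ⊗ W)^∨`. -/
def dualTensor (V W : C) : dual W ⊗ dual V ≅ dual (V ⊗ W) :=
  rightDualIso ExactPairing.tensor HasRightDual.exact

variable (C) in
/-- The canonical isomorphism `𝟙_ C ≅ (𝟙_ C)^∨`, where `(𝟙_ C)^∨` is the chosen dual. -/
def dualUnit : 𝟙_ C ≅ (RightRigidCategory.rightDual (𝟙_ C)).rightDual :=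
  rightDualIso exactPairingUnit (RightRigidCategory.rightDual (𝟙_ C)).exact

/-- The monoidal functor structure `V^∨∨ ⊗ W^∨∨ ⟶ (V ⊗ W)^∨∨` of the bidual functor, composed
from `V^∨∨ ⊗ W^∨∨ ≅ (W^∨ ⊗ V^∨)^∨` and the dual of `(V ⊗ W)^∨ ≅ W^∨ ⊗ V^∨`. -/
def bidualTensor (V W : C) : (bidual C).obj V ⊗ (bidual C).obj W ⟶ (bidual C).obj (V ⊗ W) :=
  (dualTensor (dual W) (dual V)).hom ≫ dualMap (dualTensor V W).inv

variable (C) in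
/-- The unit part `𝟙_ C ⟶ (𝟙_ C)^∨∨` of the monoidal functor structure of the bidual functor. -/
def bidualUnit : 𝟙_ C ⟶ (bidual C).obj (𝟙_ C) :=
  (dualUnit C).hom ≫ @rightAdjointMate C _ _ _ _ (RightRigidCategory.rightDual _)
    (RightRigidCategory.rightDual _) (dualUnit C).inv

variable (C) in
/-- A pivotal structure: an isomorphism `V ≅ V^∨∨` of monoidal functors. -/
structure PivotalStructure where
  /-- the natural isomorphism -/
  j : 𝟭 C ≅ bidual C
  tensor : ∀ V W : C, j.hom.app (V ⊗ W) = (j.hom.app V ⊗ₘ j.hom.app W) ≫ bidualTensor V W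
  unit : j.hom.app (𝟙_ C) = bidualUnit C

/-- `j_V : V ⟶ V^∨∨`. -/
abbrev PivotalStructure.to (P : PivotalStructure C) (V : C) : V ⟶ dual (dual V) :=
  P.j.hom.app V

/-- `j_V⁻¹ : V^∨∨ ⟶ V`. -/
abbrev PivotalStructure.from (P : PivotalStructure C) (V : C) : dual (dual V) ⟶ V :=
  P.j.inv.app V

/-- The left pivotal trace of an endomorphism. -/
def leftTrace (P : PivotalStructure C) {V : C} (f : V ⟶ V) : 𝟙_ C ⟶ 𝟙_ C :=
  db (dual V) ≫ dual V ◁ P.from V ≫ dual V ◁ f ≫ ev V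

/-- The right pivotal trace of an endomorphism. -/
def rightTrace (P : PivotalStructure C) {V : C} (f : V ⟶ V) : 𝟙_ C ⟶ 𝟙_ C :=
  db V ≫ f ▷ dual V ≫ P.to V ▷ dual V ≫ ev (dual V)

/-- A pivotal category is spherical if left and right pivotal traces agree. -/
def IsSpherical (P : PivotalStructure C) : Prop :=
  ∀ (V : C) (f : V ⟶ V), leftTrace P f = rightTrace P f

end Pivotal

/-! ### Tensor powers -/

section Power

variable {C : Type u} [Category.{v} C] [MonoidalCategory C]

/-- The tensor power `V^n` with rightmost parentheses: `V^0 = 𝟙_ C`, `V^(n+1) = V ⊗ V^n`. -/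
def tpow (V : C) : ℕ → C
  | 0 => 𝟙_ C
  | n + 1 => V ⊗ tpow V n

/-- The canonical isomorphism `V^n ⊗ V ≅ V^(n+1)` composed of structure isomorphisms. -/
def tpowAssoc (V : C) : ∀ n : ℕ, tpow V n ⊗ V ≅ tpow V (n + 1)
  | 0 => λ_ V ≪≫ (ρ_ V).symm
  | n + 1 => α_ V (tpow V n) V ≪≫ whiskerLeftIso V (tpowAssoc V n)

end Power

/-! ### Higher Frobenius-Schur indicators -/

section Indicator

variable (k : Type w) [Field k] {C : Type u} [Category.{v} C] [Abelian C] [Linear k C]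
  [MonoidalCategory C] [RightRigidCategory C]

/-- The map `A : C(I, V ⊗ W) → C(V^∨, W)`. -/
def adjA (V W : C) (f : 𝟙_ C ⟶ V ⊗ W) : dual V ⟶ W :=
  (ρ_ (dual V)).inv ≫ dual V ◁ f ≫ (α_ (dual V) V W).inv ≫ ev V ▷ W ≫ (λ_ W).hom

/-- The inverse map `C(V^∨, W) → C(I, V ⊗ W)`. -/
def adjAInv (V W : C) (g : dual V ⟶ W) : 𝟙_ C ⟶ V ⊗ W :=
  db V ≫ V ◁ g

/-- The map `T : C(V^∨, W) → C(W^∨, V)`, `f ↦ j_V⁻¹ ∘ f^∨`. -/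
def mapT (P : PivotalStructure C) (V W : C) (f : dual V ⟶ W) : dual W ⟶ V :=
  dualMap f ≫ P.from V

variable [MonoidalPreadditive C] [MonoidalLinear k C]

/-- The linear map `E_{V,W} : C(I, V ⊗ W) → C(I, W ⊗ V)`. -/
def mapE (P : PivotalStructure C) (V W : C) : (𝟙_ C ⟶ V ⊗ W) →ₗ[k] (𝟙_ C ⟶ W ⊗ V) where
  toFun f := adjAInv W V (mapT P V W (adjA V W f))
  map_add' f g := by
    simp only [adjAInv, mapT, adjA, dualMap, rightAdjointMate, Preadditive.add_comp,
      Preadditive.comp_add, MonoidalPreadditive.whiskerLeft_add,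
      MonoidalPreadditive.add_whiskerRight]
  map_smul' c f := by
    simp only [adjAInv, mapT, adjA, dualMap, rightAdjointMate, Linear.smul_comp,
      Linear.comp_smul, MonoidalLinear.whiskerLeft_smul, MonoidalLinear.smul_whiskerRight,
      RingHom.id_apply]

/-- The linear endomorphism `E_V^(n+1)` of `C(I, V^(n+1))`: the map `E_{V,V^n}` followed by
composition with the canonical isomorphism `V^n ⊗ V ≅ V^(n+1)`. -/
def rotation (P : PivotalStructure C) (V : C) (n : ℕ) :
    (𝟙_ C ⟶ tpow V (n + 1)) →ₗ[k] (𝟙_ C ⟶ tpow V (n + 1)) :=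
  Linear.rightComp k (𝟙_ C) (tpowAssoc V n).hom ∘ₗ mapE k P V (tpow V n)

/-- The Frobenius-Schur indicator `ν_{n+1}(V)`: the trace of the endomorphism `E_V^(n+1)` of
`C(I, V^(n+1))`. -/
def indicatorSucc (P : PivotalStructure C) (V : C) (n : ℕ) : k :=
  LinearMap.trace k (𝟙_ C ⟶ tpow V (n + 1)) (rotation k P V n)

end Indicator

/-! ### Frobenius-Schur endomorphisms -/

section Endomorphism

variable (k : Type w) [Field k] {C : Type u} [Category.{v} C] [Abelian C] [Linear k C]
  [MonoidalCategory C] [MonoidalPreadditive C] [MonoidalLinear k C] [IsSemisimpleMonoidalCat k C]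

/-- The Frobenius-Schur endomorphism `FS_V^(n+1)`, formed with a right dual `X` of `V^n`
(that is, morphisms `𝟙_ C ⟶ X ⊗ V^n` and `V^n ⊗ X ⟶ 𝟙_ C` satisfying the triangle identities)
and a trivial component `(T, ι, π)` of `V^(n+1)`. -/
def fsEndSucc (V : C) (n : ℕ) (X : C) [ExactPairing X (tpow V n)]
    (T : IsotypicalComponent k (𝟙_ C) (tpow V (n + 1))) : V ⟶ V :=
  (λ_ V).inv ≫ η_ X (tpow V n) ▷ V ≫ (α_ X (tpow V n) V).hom ≫
    X ◁ (tpowAssoc V n).hom ≫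
    X ◁ T.π ≫
    ((trivialBraiding k C).τ X T.obj T.isotypical).hom ≫
    T.ι ▷ X ≫
    (α_ V (tpow V n) X).hom ≫ V ◁ ε_ X (tpow V n) ≫ (ρ_ V).hom

end Endomorphism

end

end FrobeniusSchur

/-! The trace of the rotation is computed with a resolution `e a : I ⟶ V^(n+1)`, `e' a : V^(n+1) ⟶
I` such that `∑ a, x ≫ e' a ≫ e a = x` for every `x`. Then the indicator times the identity is `∑ a,
E(e a) ≫ e' a`, up to the canonical isomorphism (`indicatorSucc_smul_id`). Here `n` is one less than
the index of the indicator.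

Splitting the trivial component into copies of the unit turns the Frobenius–Schur endomorphism into
a sum of composites `V ⟶ X ⟶ V`, whose two factors are `e' a` and `e a` with one leg bent
(`fsEndSucc_eq_sum`). The left trace of such a composite no longer involves `X` and equals `E(e a) ≫
e' a` (`leftTrace_intoDual_fromDual`), so the two sums agree term by term.

For the dual object, bend the legs into `g a : V^∨ ⟶ V^n` and `h a : V^n ⟶ V^∨`. Since the pivotal
structure respects evaluations, `E(e a) ≫ e' a` is the right trace of `g a ≫ h a`
(`rightTrace_dual`). Since `V^n` is a right dual of `(V^∨)^n`, the left trace of the same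
endomorphism is a term of the sum for `V^∨`, for the resolution obtained from `g` and `h`.
Sphericity identifies the two traces. -/

namespace FrobeniusSchur

noncomputable section

attribute [local instance] Abelian.hasFiniteBiproducts

/-! ### Bending the legs of pairings and copairings. -/

section PairingCalculus

variable {C : Type u} [Category.{v} C] [MonoidalCategory C]

/-- Morphisms into a dual object are determined by the pairing they induce. -/
lemma eq_of_whiskerRight_evaluation {X Y Z : C} [ExactPairing X Y] {f g : Z ⟶ Y}
    (h : f ▷ X ≫ ε_ X Y = g ▷ X ≫ ε_ X Y) : f = g := by
  have key : ∀ f : Z ⟶ Y, f = (ρ_ Z).inv ≫ Z ◁ η_ X Y ≫ (α_ Z X Y).inv ≫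
      (f ▷ X ≫ ε_ X Y) ▷ Y ≫ (λ_ Y).hom := by
    intro f
    have : (ρ_ Z).inv ≫ Z ◁ η_ X Y ≫ (α_ Z X Y).inv ≫
      (f ▷ X ≫ ε_ X Y) ▷ Y ≫ (λ_ Y).hom =
      (ρ_ Z).inv ≫ (Z ◁ η_ X Y ≫ f ▷ (X ⊗ Y)) ≫ (α_ Y X Y).inv ≫ ε_ X Y ▷ Y ≫ (λ_ Y).hom := by
      simp
    rw [this, whisker_exchange]
    simp
  rw [key f, key g, h]

/-- The morphism `Z ⟶ Y` into a dual `Y` of `X` induced by a pairing `Z ⊗ X ⟶ 𝟙_ C`. -/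
def ofPairing {X Z : C} (Y : C) [ExactPairing X Y] (e : Z ⊗ X ⟶ 𝟙_ C) : Z ⟶ Y :=
  (ρ_ Z).inv ≫ Z ◁ η_ X Y ≫ (α_ Z X Y).inv ≫ e ▷ Y ≫ (λ_ Y).hom

lemma ofPairing_evaluation {X Y Z : C} [ExactPairing X Y] (e : Z ⊗ X ⟶ 𝟙_ C) :
    ofPairing Y e ▷ X ≫ ε_ X Y = e := by
  calc
    _ = 𝟙 _ ⊗≫ Z ◁ η_ X Y ▷ X ⊗≫ (e ▷ (Y ⊗ X) ≫ 𝟙_ C ◁ ε_ X Y) ⊗≫ 𝟙 _ := by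
      dsimp only [ofPairing]; monoidal
    _ = 𝟙 _ ⊗≫ Z ◁ (η_ X Y ▷ X ⊗≫ X ◁ ε_ X Y) ⊗≫ e ▷ 𝟙_ C ⊗≫ 𝟙 _ := by
      rw [← whisker_exchange]; monoidal
    _ = _ := by
      rw [ExactPairing.evaluation_coevaluation'']; monoidal

/-- The morphism `Y ⟶ Z` out of a dual `Y` of `X` induced by a copairing `𝟙_ C ⟶ X ⊗ Z`. -/
def ofCopairing {X Z : C} (Y : C) [ExactPairing X Y] (e : 𝟙_ C ⟶ X ⊗ Z) : Y ⟶ Z :=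
  (ρ_ Y).inv ≫ Y ◁ e ≫ (α_ Y X Z).inv ≫ ε_ X Y ▷ Z ≫ (λ_ Z).hom

/-- The morphism `V ⟶ X` induced by `W ⊗ V ⟶ 𝟙_ C` and a pairing of `X` with `W`. -/
def intoDual (X : C) {V W : C} [ExactPairing X W] (e : W ⊗ V ⟶ 𝟙_ C) : V ⟶ X :=
  (λ_ V).inv ≫ η_ X W ▷ V ≫ (α_ X W V).hom ≫ X ◁ e ≫ (ρ_ X).hom

/-- The morphism `X ⟶ V` induced by `𝟙_ C ⟶ V ⊗ W` and a pairing of `X` with `W`. -/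
def fromDual (X : C) {V W : C} [ExactPairing X W] (e : 𝟙_ C ⟶ V ⊗ W) : X ⟶ V :=
  (λ_ X).inv ≫ e ▷ X ≫ (α_ V W X).hom ≫ V ◁ ε_ X W ≫ (ρ_ V).hom

lemma intoDual_evaluation {X V W : C} [ExactPairing X W] (e : W ⊗ V ⟶ 𝟙_ C) :
    W ◁ intoDual X e ≫ ε_ X W = e := by
  calc
    _ = 𝟙 _ ⊗≫ W ◁ η_ X W ▷ V ⊗≫ ((W ⊗ X) ◁ e ≫ ε_ X W ▷ 𝟙_ C) ⊗≫ 𝟙 _ := by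
      dsimp only [intoDual]; monoidal
    _ = 𝟙 _ ⊗≫ (W ◁ η_ X W ⊗≫ ε_ X W ▷ W) ▷ V ⊗≫ 𝟙_ C ◁ e ⊗≫ 𝟙 _ := by
      rw [whisker_exchange]; monoidal
    _ = _ := by
      rw [ExactPairing.coevaluation_evaluation'']; monoidal

lemma fromDual_coevaluation {X V W : C} [ExactPairing X W] (e : 𝟙_ C ⟶ V ⊗ W) :
    η_ X W ≫ fromDual X e ▷ W = e := by
  calc
    _ = 𝟙 _ ⊗≫ (𝟙_ C ◁ η_ X W ≫ e ▷ (X ⊗ W)) ⊗≫ V ◁ ε_ X W ▷ W ⊗≫ 𝟙 _ := by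
      dsimp only [fromDual]; monoidal
    _ = 𝟙 _ ⊗≫ e ▷ 𝟙_ C ⊗≫ V ◁ (W ◁ η_ X W ⊗≫ ε_ X W ▷ W) ⊗≫ 𝟙 _ := by
      rw [whisker_exchange]; monoidal
    _ = _ := by
      rw [ExactPairing.coevaluation_evaluation'']; monoidal

lemma fromDual_coevaluation_whiskerRight {X V W : C} [ExactPairing X W] (h : X ⟶ V) :
    fromDual X (η_ X W ≫ h ▷ W) = h := by
  calc
    _ = 𝟙 _ ⊗≫ η_ X W ▷ X ⊗≫ (h ▷ (W ⊗ X) ≫ V ◁ ε_ X W) ⊗≫ 𝟙 _ := by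
      dsimp only [fromDual]; monoidal
    _ = 𝟙 _ ⊗≫ (η_ X W ▷ X ⊗≫ X ◁ ε_ X W) ⊗≫ h ▷ 𝟙_ C ⊗≫ 𝟙 _ := by
      rw [← whisker_exchange]; monoidal
    _ = _ := by
      rw [ExactPairing.evaluation_coevaluation'']; monoidal

lemma intoDual_whiskerLeft_evaluation {X V W : C} [ExactPairing X W] (g : V ⟶ X) :
    intoDual X (W ◁ g ≫ ε_ X W) = g := by
  calc
    _ = 𝟙 _ ⊗≫ (η_ X W ▷ V ≫ (X ⊗ W) ◁ g) ⊗≫ X ◁ ε_ X W ⊗≫ 𝟙 _ := by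
      dsimp only [intoDual]; monoidal
    _ = 𝟙 _ ⊗≫ g ⊗≫ (η_ X W ▷ X ⊗≫ X ◁ ε_ X W) ⊗≫ 𝟙 _ := by
      rw [← whisker_exchange]; monoidal
    _ = _ := by
      rw [ExactPairing.evaluation_coevaluation'']; monoidal

/-- Bending the `V` leg or the `W` leg of `e` gives morphisms that are mates of each other. This is
what removes `X` from the left trace. -/
lemma whiskerLeft_fromDual_evaluation {V V' W X : C} [ExactPairing V V'] [ExactPairing X W]
    (e : 𝟙_ C ⟶ V ⊗ W) :
    V' ◁ fromDual X e ≫ ε_ V V' = ofCopairing V' e ▷ X ≫ ε_ X W := by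
  calc
    _ = 𝟙 _ ⊗≫ V' ◁ e ▷ X ⊗≫ ((V' ⊗ V) ◁ ε_ X W ≫ ε_ V V' ▷ 𝟙_ C) ⊗≫ 𝟙 _ := by
      dsimp only [fromDual]; monoidal
    _ = _ := by
      rw [whisker_exchange]; dsimp only [ofCopairing]; monoidal

end PairingCalculus

/-! ### The rotation as a left trace. -/

section

variable {C : Type u} [Category.{v} C] [MonoidalCategory C] [RightRigidCategory C]

lemma adjA_eq_ofCopairing (V W : C) (e : 𝟙_ C ⟶ V ⊗ W) : adjA V W e = ofCopairing (dual V) e :=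
  rfl

/-- The rotation of `e`, paired with `e'`, in terms of the endomorphism of `V^∨` given by `e` and
`e'`. -/
lemma adjAInv_mapT_comp (P : PivotalStructure C) {V W : C} (e : 𝟙_ C ⟶ V ⊗ W)
    (e' : W ⊗ V ⟶ 𝟙_ C) :
    adjAInv W V (mapT P V W (adjA V W e)) ≫ e' =
      db (dual V) ≫ dual V ◁ P.from V ≫ ofCopairing (dual V) e ▷ V ≫ e' := by
  simp only [adjAInv, mapT, adjA_eq_ofCopairing, MonoidalCategory.whiskerLeft_comp, Category.assoc]
  -- The transpose slides around the cup `db W`, leaving `db (dual V)` with the untransposed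
  -- morphism on its left leg.
  rw [coevaluation_comp_rightAdjointMate_assoc, whisker_exchange_assoc]

lemma leftTrace_intoDual_fromDual (P : PivotalStructure C) {V W X : C} [ExactPairing X W]
    (e : 𝟙_ C ⟶ V ⊗ W) (e' : W ⊗ V ⟶ 𝟙_ C) :
    leftTrace P (intoDual X e' ≫ fromDual X e) =
      adjAInv W V (mapT P V W (adjA V W e)) ≫ e' := by
  rw [adjAInv_mapT_comp, leftTrace, MonoidalCategory.whiskerLeft_comp, Category.assoc,
    whiskerLeft_fromDual_evaluation, whisker_exchange_assoc, intoDual_evaluation]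

end

/-! ### Compatibility of the pivotal structure with evaluations. -/

section PivotalDual

variable {C : Type u} [Category.{v} C] [MonoidalCategory C]

/-- `rightDualIso` is the mate of `𝟙 X` with respect to the two duals. -/
lemma rightDualIso_hom_evaluation {X Y₁ Y₂ : C} (p₁ : ExactPairing X Y₁) (p₂ : ExactPairing X Y₂) :
    (rightDualIso p₁ p₂).hom ▷ X ≫ @ExactPairing.evaluation _ _ _ X Y₂ p₂ =
      @ExactPairing.evaluation _ _ _ X Y₁ p₁ := by
  have := @rightAdjointMate_comp_evaluation C _ _ X X ⟨Y₂⟩ ⟨Y₁⟩ (𝟙 X)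
  rw [MonoidalCategory.whiskerLeft_id, Category.id_comp] at this
  exact this

variable [RightRigidCategory C]

/-- The mate of `ev V`, up to canonical isomorphisms, is `db (dual V)`. -/
lemma dualUnit_dualMap_ev (V : C) :
    (dualUnit C).hom ≫ @rightAdjointMate C _ _ _ _ _ (RightRigidCategory.rightDual _) (ev V) =
      db (dual V) ≫ (dualTensor (dual V) V).hom := by
  -- The unit also has itself as a dual; this selects the dual chosen by the rigid structure, which
  -- is the one in `dualUnit`.
  let _ : HasRightDual (𝟙_ C) := RightRigidCategory.rightDual _
  apply eq_of_whiskerRight_evaluation (X := dual V ⊗ V)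
  have h1 := rightDualIso_hom_evaluation
    (@ExactPairing.tensor _ _ _ _ _ _ _ (HasRightDual.exact (X := dual V))
      (HasRightDual.exact (X := V))) (RightRigidCategory.rightDual (dual V ⊗ V)).exact
  have h2 := rightDualIso_hom_evaluation exactPairingUnit (RightRigidCategory.rightDual (𝟙_ C)).exact
  have h3 := rightAdjointMate_comp_evaluation (ev V)
  rw [comp_whiskerRight, Category.assoc, comp_whiskerRight, Category.assoc]
  erw [h3, h1]
  erw [← whisker_exchange_assoc, h2]
  have : @ExactPairing.evaluation _ _ _ (dual V ⊗ V) (dual V ⊗ dual (dual V))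
      (ExactPairing.tensor) = 𝟙 _ ⊗≫ dual V ◁ (ev (dual V) ▷ V) ⊗≫ ev V := rfl
  rw [this]
  have h4 : @ExactPairing.evaluation _ _ _ (𝟙_ C) (𝟙_ C) exactPairingUnit = (ρ_ _).hom := rfl
  rw [h4]
  symm
  calc
    _ = 𝟙 _ ⊗≫ (db (dual V) ▷ dual V ⊗≫ dual V ◁ ev (dual V)) ▷ V ⊗≫ ev V := by monoidal
    _ = _ := by rw [ExactPairing.evaluation_coevaluation'']; monoidal

/-- The mate of `db V`, up to canonical isomorphisms, is `ev (dual V)`. -/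
lemma dualTensor_dualMap_db (V : C) :
    (dualTensor V (dual V)).hom ≫
      @rightAdjointMate C _ _ _ _ (RightRigidCategory.rightDual _) _ (db V) =
      ev (dual V) ≫ (dualUnit C).hom := by
  let _ : HasRightDual (𝟙_ C) := RightRigidCategory.rightDual _
  apply eq_of_whiskerRight_evaluation (X := 𝟙_ C)
  have h1 := rightDualIso_hom_evaluation
    (@ExactPairing.tensor _ _ _ _ _ _ _ (HasRightDual.exact (X := V))
      (HasRightDual.exact (X := dual V))) (RightRigidCategory.rightDual (V ⊗ dual V)).exact
  have h2 := rightDualIso_hom_evaluation exactPairingUnit (RightRigidCategory.rightDual (𝟙_ C)).exact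
  have h3 := rightAdjointMate_comp_evaluation (db V)
  rw [comp_whiskerRight, Category.assoc, comp_whiskerRight, Category.assoc]
  erw [h3, h2]
  erw [← whisker_exchange_assoc, h1]
  have : @ExactPairing.evaluation _ _ _ (V ⊗ dual V) (dual (dual V) ⊗ dual V)
      (ExactPairing.tensor) = 𝟙 _ ⊗≫ dual (dual V) ◁ (ev V ▷ dual V) ⊗≫ ev (dual V) := rfl
  rw [this]
  have h4 : @ExactPairing.evaluation _ _ _ (𝟙_ C) (𝟙_ C) exactPairingUnit = (ρ_ _).hom := rfl
  rw [h4]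
  calc
    _ = 𝟙 _ ⊗≫ dual (dual V) ◁ (dual V ◁ db V ⊗≫ ev V ▷ dual V) ⊗≫ ev (dual V) := by monoidal
    _ = _ := by rw [ExactPairing.coevaluation_evaluation'']; monoidal

/-- The monoidal structure of the bidual functor takes the evaluation of `V` to that of its
bidual. -/
lemma bidualTensor_bidual_map_ev (V : C) :
    bidualTensor (dual V) V ≫ (bidual C).map (ev V) = ev (dual (dual V)) ≫ bidualUnit C := by
  let _ : HasRightDual (𝟙_ C) := RightRigidCategory.rightDual _
  have h1 := dualUnit_dualMap_ev V
  have h2 := dualTensor_dualMap_db (dual V)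
  -- The bidual is a transpose applied twice: the first turns `ev` into `db`, the second turns that
  -- `db` back into `ev`.
  have h3 : dualMap (ev V) ≫ (dualTensor (dual V) V).inv = (dualUnit C).inv ≫ db (dual V) := by
    rw [Iso.comp_inv_eq, Category.assoc, Iso.eq_inv_comp]; exact h1
  calc
    _ = (dualTensor (dual V) (dual (dual V))).hom ≫
        dualMap (dualMap (ev V) ≫ (dualTensor (dual V) V).inv) := by
      simp only [dualMap, comp_rightAdjointMate]
      exact Category.assoc _ _ _
    _ = _ := by
      rw [h3]
      simp only [dualMap, comp_rightAdjointMate]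
      rw [reassoc_of% h2]
      rfl

instance isIso_bidualUnit : IsIso (bidualUnit C) := by
  let _ : HasRightDual (𝟙_ C) := RightRigidCategory.rightDual _
  have : IsIso (dualMap (dualUnit C).inv) :=
    ⟨dualMap (dualUnit C).hom, by simp [dualMap, ← comp_rightAdjointMate],
      by simp [dualMap, ← comp_rightAdjointMate]⟩
  exact IsIso.comp_isIso' inferInstance this

/-- A pivotal structure is compatible with evaluations. -/
lemma PivotalStructure.tensorHom_ev (P : PivotalStructure C) (V : C) :
    (P.to (dual V) ⊗ₘ P.to V) ≫ ev (dual (dual V)) = ev V := by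
  -- Naturality at `ev V`, with `j` at the tensor product and at the unit replaced by the monoidal
  -- structure; the invertible `bidualUnit` then cancels.
  have h := P.j.hom.naturality (ev V)
  rw [P.tensor, P.unit, Category.assoc] at h
  erw [bidualTensor_bidual_map_ev] at h
  rw [← cancel_mono (bidualUnit C), Category.assoc]
  exact h.symm

lemma PivotalStructure.whiskerRight_ev (P : PivotalStructure C) (V : C) :
    P.to (dual V) ▷ dual (dual V) ≫ ev (dual (dual V)) = dual V ◁ P.from V ≫ ev V := by
  have h : dual V ◁ P.from V ≫ dual V ◁ P.to V = 𝟙 _ := by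
    rw [← MonoidalCategory.whiskerLeft_comp]
    erw [P.j.inv_hom_id_app]
    exact MonoidalCategory.whiskerLeft_id _ _
  rw [← P.tensorHom_ev V, tensorHom_def', Category.assoc]
  erw [reassoc_of% h]

/-- The right pivotal trace of an endomorphism of a dual object. -/
lemma rightTrace_dual (P : PivotalStructure C) {V : C} (f : dual V ⟶ dual V) :
    rightTrace P f = db (dual V) ≫ dual V ◁ P.from V ≫ f ▷ V ≫ ev V := by
  rw [rightTrace, P.whiskerRight_ev, whisker_exchange_assoc]

end PivotalDual

/-! ### The pairing of tensor powers of an object and of its dual. -/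

section PowerPairing

variable {C : Type u} [Category.{v} C] [MonoidalCategory C]

/-- The nested pairing of `Y₂ ⊗ Y₁` with `X₁ ⊗ X₂`. -/
def nest {X₁ Y₁ X₂ Y₂ : C} (e₁ : Y₁ ⊗ X₁ ⟶ 𝟙_ C) (e₂ : Y₂ ⊗ X₂ ⟶ 𝟙_ C) :
    (Y₂ ⊗ Y₁) ⊗ (X₁ ⊗ X₂) ⟶ 𝟙_ C :=
  𝟙 _ ⊗≫ Y₂ ◁ (e₁ ▷ X₂) ⊗≫ e₂

lemma nest_assoc {X₁ Y₁ X₂ Y₂ X₃ Y₃ : C} (e₁ : Y₁ ⊗ X₁ ⟶ 𝟙_ C) (e₂ : Y₂ ⊗ X₂ ⟶ 𝟙_ C)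
    (e₃ : Y₃ ⊗ X₃ ⟶ 𝟙_ C) :
    (α_ Y₃ Y₂ Y₁).hom ▷ ((X₁ ⊗ X₂) ⊗ X₃) ≫ nest (nest e₁ e₂) e₃ =
      ((Y₃ ⊗ Y₂) ⊗ Y₁) ◁ (α_ X₁ X₂ X₃).hom ≫ nest e₁ (nest e₂ e₃) := by
  dsimp only [nest]
  monoidal

lemma nest_whiskerLeft {X₁ Y₁ X₂ X₂' Y₂ : C} (e₁ : Y₁ ⊗ X₁ ⟶ 𝟙_ C) (e₂ : Y₂ ⊗ X₂ ⟶ 𝟙_ C)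
    (f : X₂' ⟶ X₂) :
    nest e₁ (Y₂ ◁ f ≫ e₂) = (Y₂ ⊗ Y₁) ◁ (X₁ ◁ f) ≫ nest e₁ e₂ := by
  calc
    _ = 𝟙 _ ⊗≫ Y₂ ◁ (e₁ ▷ X₂' ≫ 𝟙_ C ◁ f) ⊗≫ e₂ := by
      dsimp only [nest]; monoidal
    _ = _ := by
      rw [← whisker_exchange]; dsimp only [nest]; monoidal

lemma nest_whiskerRight {X₁ Y₁ Y₁' X₂ Y₂ : C} (e₁ : Y₁ ⊗ X₁ ⟶ 𝟙_ C) (e₂ : Y₂ ⊗ X₂ ⟶ 𝟙_ C)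
    (f : Y₁' ⟶ Y₁) :
    nest (f ▷ X₁ ≫ e₁) e₂ = (Y₂ ◁ f) ▷ (X₁ ⊗ X₂) ≫ nest e₁ e₂ := by
  dsimp only [nest]
  monoidal

lemma nest_unit {X Y : C} (e : Y ⊗ X ⟶ 𝟙_ C) :
    (𝟙_ C ⊗ Y) ◁ ((λ_ X).hom ≫ (ρ_ X).inv) ≫ nest e (ρ_ (𝟙_ C)).hom =
      ((λ_ Y).hom ≫ (ρ_ Y).inv) ▷ (𝟙_ C ⊗ X) ≫ nest (ρ_ (𝟙_ C)).hom e := by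
  dsimp only [nest]
  monoidal

/-- Bending a leg and then evaluating amounts to one nested evaluation of all strands. With
`fromDual_whiskerRight`, this makes the two sides of `pairing_rotation` comparable. -/
lemma whiskerLeft_ofCopairing_evaluation {V V' W W' : C} [ExactPairing V V'] (e : 𝟙_ C ⟶ V ⊗ W)
    (ε : W' ⊗ W ⟶ 𝟙_ C) :
    W' ◁ ofCopairing V' e ≫ ε = (ρ_ _).inv ≫ (W' ⊗ V') ◁ e ≫ nest (ε_ V V') ε := by
  dsimp only [ofCopairing, nest]
  monoidal

lemma fromDual_whiskerRight {V V' W W' : C} [ExactPairing W W'] (x : 𝟙_ C ⟶ V' ⊗ W')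
    (ε : V' ⊗ V ⟶ 𝟙_ C) :
    fromDual W x ▷ V ≫ ε = (λ_ _).inv ≫ x ▷ (W ⊗ V) ≫ nest (ε_ W W') ε := by
  dsimp only [fromDual, nest]
  monoidal

/-- The pairing of `V ⊗ W` with `V' ⊗ W'` given by duals `V'` of `V` and `W'` of `W`, and an
isomorphism `W ⊗ V ≅ V ⊗ W`. -/
@[reducible]
def exactPairingTensorOfIso {V V' W W' : C} (pV : ExactPairing V V') (pW : ExactPairing W W')
    (c : W ⊗ V ≅ V ⊗ W) : ExactPairing (V ⊗ W) (V' ⊗ W') :=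
  exactPairingCongrLeft c.symm

lemma inv_whiskerRight_eq_whiskerLeft_inv {A A' B B' Z : C} (c : A ≅ A') (c' : B ≅ B')
    {p : B ⊗ A' ⟶ Z} {q : B' ⊗ A ⟶ Z} (h : B ◁ c.hom ≫ p = c'.hom ▷ A ≫ q) :
    c'.inv ▷ A' ≫ p = B' ◁ c.inv ≫ q := by
  have hp : p = B ◁ c.inv ≫ c'.hom ▷ A ≫ q := by
    rw [← h, ← MonoidalCategory.whiskerLeft_comp_assoc]
    simp
  rw [hp, ← whisker_exchange_assoc, ← comp_whiskerRight_assoc]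
  simp

/-- `h` makes `c` and `c'` adjoint for the two pairings; the rest is the interchange law, by which
`x` and `e` may be inserted in either order. -/
lemma comp_pairing_eq_comp_pairing {A A' B B' : C} (c : A ≅ A') (c' : B ≅ B')
    {p : B ⊗ A' ⟶ 𝟙_ C} {q : B' ⊗ A ⟶ 𝟙_ C} (h : B ◁ c.hom ≫ p = c'.hom ▷ A ≫ q)
    (x : 𝟙_ C ⟶ B') (e : 𝟙_ C ⟶ A') :
    x ≫ c'.inv ≫ (ρ_ _).inv ≫ B ◁ e ≫ p = e ≫ c.inv ≫ (λ_ _).inv ≫ x ▷ A ≫ q := by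
  calc
    _ = x ≫ (ρ_ _).inv ≫ (c'.inv ▷ 𝟙_ C ≫ B ◁ e) ≫ p := by simp
    _ = (ρ_ _).inv ≫ (x ▷ 𝟙_ C ≫ B' ◁ e) ≫ c'.inv ▷ A' ≫ p := by
      rw [← whisker_exchange]; simp
    _ = (λ_ _).inv ≫ 𝟙_ C ◁ e ≫ (x ▷ A' ≫ B' ◁ c.inv) ≫ q := by
      rw [inv_whiskerRight_eq_whiskerLeft_inv c c' h, ← whisker_exchange]
      simp [unitors_inv_equal]
    _ = _ := by
      rw [← whisker_exchange]; simp

/-- Expanding `ε₁` by `h` on one side and by `h'` on the other gives the two bracketings of the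
triple nest of `e`, `ε`, `e`. -/
lemma nest_assoc_of_eq {V V' W W' : C} {e : V' ⊗ V ⟶ 𝟙_ C} {ε : W' ⊗ W ⟶ 𝟙_ C}
    (c : W ⊗ V ≅ V ⊗ W) (c' : W' ⊗ V' ≅ V' ⊗ W') {ε₁ : (V' ⊗ W') ⊗ (V ⊗ W) ⟶ 𝟙_ C}
    (h : ε₁ = (V' ⊗ W') ◁ c.inv ≫ nest ε e) (h' : ε₁ = c'.inv ▷ (V ⊗ W) ≫ nest e ε) :
    ((V' ⊗ W') ⊗ V') ◁ ((α_ V W V).hom ≫ V ◁ c.hom) ≫ nest e ε₁ =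
      ((α_ V' W' V').hom ≫ V' ◁ c'.hom) ▷ ((V ⊗ W) ⊗ V) ≫ nest ε₁ e := by
  have e1 : nest e ε₁ = _ := (congrArg (nest e) h).trans (nest_whiskerLeft _ _ _)
  have e2 : nest ε₁ e = _ := (congrArg (fun t => nest t e) h').trans (nest_whiskerRight _ _ _)
  have e3 := nest_assoc e ε e
  rw [e1, e2, ← MonoidalCategory.whiskerLeft_comp_assoc, ← comp_whiskerRight_assoc]
  simpa using e3.symm

variable [RightRigidCategory C]

/-- The pairing of `V^n` with `(V^∨)^n`. -/
instance tpowPairing (V : C) : ∀ n : ℕ, ExactPairing (tpow V n) (tpow (dual V) n)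
  | 0 => exactPairingUnit
  -- Duality reverses tensor products, so `V^∨ ⊗ (V^∨)^n` is naturally dual to `V^n ⊗ V`;
  -- `tpowAssoc` moves the last factor to the front.
  | n + 1 => exactPairingTensorOfIso HasRightDual.exact (tpowPairing V n) (tpowAssoc V n)

/-- The canonical isomorphisms `V^n ⊗ V ≅ V^(n+1)` and `(V^∨)^n ⊗ V^∨ ≅ (V^∨)^(n+1)` are mates of
each other. -/
lemma tpowAssoc_nest (V : C) (n : ℕ) :
    (tpow (dual V) n ⊗ dual V) ◁ (tpowAssoc V n).hom ≫
        nest (ev V) (ε_ (tpow V n) (tpow (dual V) n)) =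
      (tpowAssoc (dual V) n).hom ▷ (tpow V n ⊗ V) ≫
        nest (ε_ (tpow V n) (tpow (dual V) n)) (ev V) := by
  induction n with
  | zero => exact nest_unit (ev V)
  | succ n ih =>
    have hε : ε_ (tpow V (n + 1)) (tpow (dual V) (n + 1)) =
        (dual V ⊗ tpow (dual V) n) ◁ (tpowAssoc V n).inv ≫
          nest (ε_ (tpow V n) (tpow (dual V) n)) (ev V) := rfl
    -- By definition `ev V` is the outermost pairing; the induction hypothesis makes it the
    -- innermost one.
    have hε' : ε_ (tpow V (n + 1)) (tpow (dual V) (n + 1)) =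
        (tpowAssoc (dual V) n).inv ▷ (V ⊗ tpow V n) ≫
          nest (ev V) (ε_ (tpow V n) (tpow (dual V) n)) :=
      hε.trans (inv_whiskerRight_eq_whiskerLeft_inv _ _ ih).symm
    exact nest_assoc_of_eq (tpowAssoc V n) (tpowAssoc (dual V) n) hε hε'

lemma pairing_rotation (V : C) (n : ℕ) (x : 𝟙_ C ⟶ dual V ⊗ tpow (dual V) n)
    (e : 𝟙_ C ⟶ V ⊗ tpow V n) :
    x ≫ (tpowAssoc (dual V) n).inv ≫ tpow (dual V) n ◁ ofCopairing (dual V) e ≫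
        ε_ (tpow V n) (tpow (dual V) n) =
      e ≫ (tpowAssoc V n).inv ≫ fromDual (tpow V n) x ▷ V ≫ ev V := by
  rw [whiskerLeft_ofCopairing_evaluation, fromDual_whiskerRight]
  exact comp_pairing_eq_comp_pairing _ _ (tpowAssoc_nest V n) x e

end PowerPairing

/-! ### Isotypical components and Schur's lemma. -/

section SemisimpleFacts

variable (k : Type w) [Field k] {C : Type u} [Category.{v} C] [Abelian C] [Linear k C]

lemma isIsotypical_biproduct {J : Type} [Fintype J] (f : J → C) {R : C}
    (h : ∀ a, Nonempty (f a ≅ R)) : IsIsotypical R (⨁ f) :=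
  ⟨Fintype.card J, ⟨biproduct.whiskerEquiv (Fintype.equivFin J) fun a => (h a).some.symm⟩⟩

/-- Every object of a semisimple category has isotypical components. -/
lemma nonempty_isotypicalComponent [IsSemisimpleCat k C] (S V : C) :
    Nonempty (IsotypicalComponent k S V) := by
  classical
  obtain ⟨m, R, hR, ⟨e⟩⟩ := IsSemisimpleCat.exists_decomposition (k := k) V
  let r : Setoid (Fin m) :=
    { r := fun a b => Nonempty (R a ≅ R b)
      iseqv := ⟨fun _ => ⟨Iso.refl _⟩, fun ⟨i⟩ => ⟨i.symm⟩, fun ⟨i⟩ ⟨j⟩ => ⟨i ≪≫ j⟩⟩ }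
  -- The isomorphism classes of simple summands other than that of `S`; `s` numbers them, and `p c`
  -- selects the summands in class `c`.
  let J := {x : Quotient r // ¬ Nonempty (R x.out ≅ S)}
  let s : Fin (Fintype.card J) ≃ J := (Fintype.equivFin J).symm
  let p : Fin (Fintype.card J) → Fin m → Prop := fun c a => ⟦a⟧ = (s c).1
  let p₀ : Fin m → Prop := fun a => Nonempty (R a ≅ S)
  have hout : ∀ a : Fin m, Nonempty (R a ≅ R (⟦a⟧ : Quotient r).out) := fun a =>
    (Quotient.exact (Quotient.out_eq (⟦a⟧ : Quotient r)).symm : r a _)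
  refine ⟨{
    obj := ⨁ Subtype.restrict p₀ R
    ι := biproduct.fromSubtype R p₀ ≫ e.inv
    π := e.hom ≫ biproduct.toSubtype R p₀
    isotypical := isIsotypical_biproduct _ fun a => a.2
    ι_π := by simp
    exists_complement := ⟨Fintype.card J, fun c => R (s c).1.out,
      fun c => ⨁ Subtype.restrict (p c) R,
      fun c => biproduct.fromSubtype R (p c) ≫ e.inv,
      fun c => e.hom ≫ biproduct.toSubtype R (p c),
      fun c => hR _, fun c => not_nonempty_iff.mp (s c).2, ?_,
      fun c => isIsotypical_biproduct _ ?_, fun c => by simp, ?_⟩ }⟩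
  · rintro a b h
    have : ⟦(s a).1.out⟧ = ⟦(s b).1.out⟧ := Quotient.sound (s := r) h
    rw [Quotient.out_eq, Quotient.out_eq] at this
    exact s.injective (Subtype.ext this)
  · rintro ⟨a, ha⟩
    have := hout a
    rw [show (⟦a⟧ : Quotient r) = (s c).1 from ha] at this
    exact this
  · have key : biproduct.toSubtype R p₀ ≫ biproduct.fromSubtype R p₀ +
        ∑ c, biproduct.toSubtype R (p c) ≫ biproduct.fromSubtype R (p c) = 𝟙 (⨁ R) := by
      -- On each simple summand exactly one of the projections is the identity and the others
      -- vanish.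
      refine biproduct.hom_ext' _ _ fun a => ?_
      simp only [biproduct.toSubtype_fromSubtype, Preadditive.comp_add, Preadditive.comp_sum,
        biproduct.ι_map, Category.comp_id]
      by_cases ha : p₀ a
      · have : ∀ c, ¬ p c a := by
          intro c hc
          obtain ⟨i⟩ := hout a
          rw [show (⟦a⟧ : Quotient r) = (s c).1 from hc] at i
          exact (s c).2 ⟨i.symm ≪≫ ha.some⟩
        simp [ha, this]
      · have hJ : ¬ Nonempty (R (⟦a⟧ : Quotient r).out ≅ S) := fun ⟨i⟩ =>
          ha ⟨(hout a).some ≪≫ i⟩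
        have : ∀ c, p c a ↔ c = s.symm ⟨⟦a⟧, hJ⟩ := by
          intro c
          rw [Equiv.eq_symm_apply, Subtype.ext_iff]
          exact eq_comm
        rw [Finset.sum_eq_single (s.symm ⟨⟦a⟧, hJ⟩)]
        · simp [ha, this]
        · intro c _ hc
          simp [this, hc]
        · simp
    have := congrArg (fun t => e.hom ≫ t ≫ e.inv) key
    simpa [Preadditive.comp_sum, Preadditive.sum_comp, Preadditive.comp_add, Preadditive.add_comp]
      using this

lemma hom_eq_zero_of_isEmpty_iso {S R : C} (hS : IsSimpleObj k S) (hR : IsSimpleObj k R)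
    (h : IsEmpty (S ≅ R)) (f : S ⟶ R) : f = 0 := by
  have := hS.1
  have := hR.1
  by_contra hf
  have := isIso_of_hom_simple hf
  exact h.false (asIso f)

variable {k}

/-- By Schur's lemma `f` dies in every other component, so only `π ≫ ι` survives in the
decomposition of the identity. -/
lemma IsotypicalComponent.comp_π_ι {S V : C} (T : IsotypicalComponent k S V)
    (hS : IsSimpleObj k S) (f : S ⟶ V) : f ≫ T.π ≫ T.ι = f := by
  obtain ⟨m, R, Y, i, p, hR, hRS, -, hY, -, hsum⟩ := T.exists_complement
  have h0 : ∀ a, f ≫ p a = 0 := by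
    intro a
    obtain ⟨l, ⟨e⟩⟩ := hY a
    rw [← cancel_mono e.hom, zero_comp]
    refine biproduct.hom_ext _ _ fun b => ?_
    rw [zero_comp]
    exact hom_eq_zero_of_isEmpty_iso k hS (hR a) ⟨fun j => (hRS a).false j.symm⟩ _
  have := congrArg (fun t => f ≫ t) hsum
  simpa [Preadditive.comp_add, Preadditive.comp_sum, reassoc_of% h0] using this

lemma IsotypicalComponent.π_ι_comp {S V : C} (T : IsotypicalComponent k S V)
    (hS : IsSimpleObj k S) (f : V ⟶ S) : T.π ≫ T.ι ≫ f = f := by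
  obtain ⟨m, R, Y, i, p, hR, hRS, -, hY, -, hsum⟩ := T.exists_complement
  have h0 : ∀ a, i a ≫ f = 0 := by
    intro a
    obtain ⟨l, ⟨e⟩⟩ := hY a
    rw [← cancel_epi e.inv, comp_zero]
    refine biproduct.hom_ext' _ _ fun b => ?_
    rw [comp_zero]
    exact hom_eq_zero_of_isEmpty_iso k (hR a) hS (hRS a) _
  have := congrArg (fun t => t ≫ f) hsum
  simpa [Preadditive.add_comp, Preadditive.sum_comp, h0] using this

end SemisimpleFacts

/-! ### Traces from resolutions of the identity. -/

section TraceFormula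

variable (k : Type w) [Field k] {C : Type u} [Category.{v} C] [Abelian C] [Linear k C]

/-- The trace of an endomorphism of `C(S, U)`, computed with a resolution of the identity. -/
lemma trace_smul_id_eq_sum {S U : C} (hS : IsSimpleObj k S) [FiniteDimensional k (S ⟶ U)]
    {m : ℕ} (e : Fin m → (S ⟶ U)) (e' : Fin m → (U ⟶ S))
    (h : ∀ x : S ⟶ U, ∑ a, x ≫ e' a ≫ e a = x) (F : (S ⟶ U) →ₗ[k] (S ⟶ U)) :
    LinearMap.trace k (S ⟶ U) F • 𝟙 S = ∑ a, F (e a) ≫ e' a := by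
  let s : k ≃ₗ[k] (S ⟶ S) := LinearEquiv.ofBijective (LinearMap.toSpanSingleton k _ (𝟙 S)) hS.2
  have hs : ∀ f : S ⟶ S, s.symm f • 𝟙 S = f := fun f => s.apply_symm_apply f
  let l : Fin m → ((S ⟶ U) →ₗ[k] k) := fun a => s.symm.toLinearMap ∘ₗ Linear.rightComp k S (e' a)
  have hl : ∀ a x, l a x • 𝟙 S = x ≫ e' a := fun a x => hs _
  -- `F` is a sum of maps of rank at most one, with traces `l a (F (e a))`; the `e a` need not be a
  -- basis.
  have hF : F = ∑ a, (l a).smulRight (F (e a)) := by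
    ext x
    conv_lhs => rw [← h x]
    simp only [map_sum, LinearMap.sum_apply, LinearMap.smulRight_apply, ← map_smul]
    refine Finset.sum_congr rfl fun a _ => congrArg _ ?_
    rw [← Category.assoc, ← hl, Linear.smul_comp, Category.id_comp]
  conv_lhs => rw [hF]
  simp only [map_sum, LinearMap.trace_smulRight, Finset.sum_smul, hl]

end TraceFormula

/-! ### The two statements about indicators. -/

section IndicatorTheorem

variable (k : Type w) [Field k] {C : Type u} [Category.{v} C] [Abelian C] [Linear k C]
  [MonoidalCategory C] [MonoidalPreadditive C]

section

variable {C : Type u} [Category.{v} C] [Abelian C]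
  [MonoidalCategory C] [MonoidalPreadditive C]

/-- The canonical isomorphisms for trivial objects, in terms of a decomposition into copies of the
unit object. -/
lemma TrivialBraiding.hom_eq_sum (t : TrivialBraiding C) {V T : C} (hT : IsTrivialObj T) {m : ℕ}
    (p : Fin m → (T ⟶ 𝟙_ C)) (q : Fin m → (𝟙_ C ⟶ T)) (h : ∑ a, p a ≫ q a = 𝟙 T) :
    (t.τ V T hT).hom = ∑ a, V ◁ p a ≫ (ρ_ V).hom ≫ (λ_ V).inv ≫ q a ▷ V := by
  have hq : ∀ a, V ◁ q a ≫ (t.τ V T hT).hom = (ρ_ V).hom ≫ (λ_ V).inv ≫ q a ▷ V := by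
    intro a
    have := t.naturality isTrivialObj_unit hT (𝟙 V) (q a)
    rw [t.unit] at this
    simpa using this
  calc
    _ = V ◁ (∑ a, p a ≫ q a) ≫ (t.τ V T hT).hom := by rw [h]; simp
    _ = _ := by
      simp only [whiskerLeft_sum, Preadditive.sum_comp, MonoidalCategory.whiskerLeft_comp,
        Category.assoc, hq]

lemma leftTrace_sum [RightRigidCategory C] (P : PivotalStructure C) {V : C} {m : ℕ}
    (f : Fin m → (V ⟶ V)) :
    leftTrace P (∑ a, f a) = ∑ a, leftTrace P (f a) := by
  simp only [leftTrace, whiskerLeft_sum, Preadditive.sum_comp, Preadditive.comp_sum]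

end

variable [MonoidalLinear k C]

/-- On a copy of the unit `τ` is just unitors, so each summand is cut along the strand `X`. -/
lemma fsEndSucc_eq_sum [IsSemisimpleMonoidalCat k C] (V : C) (n : ℕ) (X : C)
    [ExactPairing X (tpow V n)] (T : IsotypicalComponent k (𝟙_ C) (tpow V (n + 1)))
    {m : ℕ} (p : Fin m → (T.obj ⟶ 𝟙_ C)) (q : Fin m → (𝟙_ C ⟶ T.obj))
    (h : ∑ a, p a ≫ q a = 𝟙 T.obj) :
    fsEndSucc k V n X T = ∑ a, intoDual X ((tpowAssoc V n).hom ≫ T.π ≫ p a) ≫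
      fromDual (V := V) (W := tpow V n) X (q a ≫ T.ι) := by
  have ht := (trivialBraiding k C).hom_eq_sum (V := X) T.isotypical p q h
  rw [fsEndSucc]
  erw [ht]
  simp only [Preadditive.sum_comp, Preadditive.comp_sum]
  refine Finset.sum_congr rfl fun a _ => ?_
  simp only [intoDual, fromDual, MonoidalCategory.whiskerLeft_comp, Category.assoc]
  erw [comp_whiskerRight_assoc]
  rfl

/-- The morphisms between the unit object and `U` have a resolution of the identity. -/
lemma exists_resolution [IsSemisimpleMonoidalCat k C] (U : C) :
    ∃ (m : ℕ) (e : Fin m → (𝟙_ C ⟶ U)) (e' : Fin m → (U ⟶ 𝟙_ C)),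
      (∀ x : 𝟙_ C ⟶ U, ∑ a, x ≫ e' a ≫ e a = x) ∧
      ∀ y : U ⟶ 𝟙_ C, ∑ a, e' a ≫ e a ≫ y = y := by
  obtain ⟨T⟩ := nonempty_isotypicalComponent k (𝟙_ C) U
  obtain ⟨m, p, q, -, hpq⟩ := IsTrivialObj.exists_data T.isotypical
  have h : ∑ a, (T.π ≫ p a) ≫ (q a ≫ T.ι) = T.π ≫ T.ι := by
    calc
      _ = T.π ≫ (∑ a, p a ≫ q a) ≫ T.ι := by
        simp only [Preadditive.comp_sum, Preadditive.sum_comp, Category.assoc]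
      _ = _ := by rw [hpq, Category.id_comp]
  refine ⟨m, fun a => q a ≫ T.ι, fun a => T.π ≫ p a, fun x => ?_, fun y => ?_⟩
  · rw [← Preadditive.comp_sum, h, T.comp_π_ι IsSemisimpleMonoidalCat.simple_unit]
  · simp only [← Category.assoc _ _ y]
    rw [← Preadditive.sum_comp, h, Category.assoc,
      T.π_ι_comp IsSemisimpleMonoidalCat.simple_unit]

variable [RightRigidCategory C]

/-- The indicator, computed with a resolution of the identity of `C(I, V^(n+1))`. -/
lemma indicatorSucc_smul_id [IsSemisimpleMonoidalCat k C] (P : PivotalStructure C) (V : C) (n : ℕ)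
    {m : ℕ} (e : Fin m → (𝟙_ C ⟶ tpow V (n + 1))) (e' : Fin m → (tpow V (n + 1) ⟶ 𝟙_ C))
    (h : ∀ x : 𝟙_ C ⟶ tpow V (n + 1), ∑ a, x ≫ e' a ≫ e a = x) :
    indicatorSucc k P V n • 𝟙 (𝟙_ C) =
      ∑ a, adjAInv (tpow V n) V (mapT P V (tpow V n) (adjA V (tpow V n) (e a))) ≫
        (tpowAssoc V n).hom ≫ e' a := by
  have := IsSemisimpleCat.finiteDimensional (k := k) (𝟙_ C) (tpow V (n + 1))
  rw [indicatorSucc, trace_smul_id_eq_sum k IsSemisimpleMonoidalCat.simple_unit e e' h]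
  exact Finset.sum_congr rfl fun a _ => Category.assoc _ _ _

/-- The left pivotal trace of the Frobenius-Schur endomorphism is the indicator. -/
lemma leftTrace_fsEndSucc [IsSemisimpleMonoidalCat k C] (P : PivotalStructure C) (V : C) (n : ℕ)
    (X : C) [ExactPairing X (tpow V n)] (T : IsotypicalComponent k (𝟙_ C) (tpow V (n + 1))) :
    leftTrace P (fsEndSucc k V n X T) = indicatorSucc k P V n • 𝟙 (𝟙_ C) := by
  obtain ⟨m, p, q, -, hpq⟩ := IsTrivialObj.exists_data T.isotypical
  rw [fsEndSucc_eq_sum k V n X T p q hpq, leftTrace_sum,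
    indicatorSucc_smul_id k P V n (fun a => q a ≫ T.ι) (fun a => T.π ≫ p a)]
  · refine Finset.sum_congr rfl fun a _ => ?_
    exact leftTrace_intoDual_fromDual P _ _
  · intro x
    calc
      _ = x ≫ T.π ≫ (∑ a, p a ≫ q a) ≫ T.ι := by
        simp only [Preadditive.comp_sum, Preadditive.sum_comp, Category.assoc]
      _ = x := by
        rw [hpq, Category.id_comp, T.comp_π_ι IsSemisimpleMonoidalCat.simple_unit]

/-- In a spherical category, the indicators of an object and of its dual agree. -/
lemma indicatorSucc_dual [IsSemisimpleMonoidalCat k C] (P : PivotalStructure C)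
    (hP : IsSpherical P) (V : C) (n : ℕ) :
    indicatorSucc k P V n = indicatorSucc k P (dual V) n := by
  have hI : IsSimpleObj k (𝟙_ C) := IsSemisimpleMonoidalCat.simple_unit
  apply hI.2.1
  obtain ⟨m, e, e', he, he'⟩ := exists_resolution k (tpow V (n + 1))
  let g : Fin m → (dual V ⟶ tpow V n) := fun a => ofCopairing (dual V) (Z := tpow V n) (e a)
  let h : Fin m → (tpow V n ⟶ dual V) := fun a => ofPairing (dual V) ((tpowAssoc V n).hom ≫ e' a)
  -- `f` and `f'` are chosen so that bending their legs with respect to `tpow V n` returns `h` and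
  -- `g`.
  let f : Fin m → (𝟙_ C ⟶ dual V ⊗ tpow (dual V) n) := fun a =>
    η_ (tpow V n) (tpow (dual V) n) ≫ h a ▷ tpow (dual V) n
  let f' : Fin m → (dual V ⊗ tpow (dual V) n ⟶ 𝟙_ C) := fun a =>
    (tpowAssoc (dual V) n).inv ≫ tpow (dual V) n ◁ g a ≫ ε_ (tpow V n) (tpow (dual V) n)
  have hres : ∀ x : 𝟙_ C ⟶ dual V ⊗ tpow (dual V) n, ∑ a, x ≫ f' a ≫ f a = x := by
    intro x
    have hx := fromDual_coevaluation (X := tpow V n) x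
    choose r hr using fun a => hI.2.2 (x ≫ f' a)
    have hr' : ∀ a, r a • 𝟙 (𝟙_ C) =
        e a ≫ (tpowAssoc V n).inv ≫ fromDual (tpow V n) x ▷ V ≫ ev V := fun a =>
      (hr a).trans (pairing_rotation V n x (e a))
    -- By `pairing_rotation`, `r a` is the value on `e a` of the functional on `V^(n+1)` given by
    -- `x`. Expanding that functional with `he'` gives the sum.
    have hsum : ∑ a, r a • h a = fromDual (tpow V n) x := by
      apply eq_of_whiskerRight_evaluation (X := V)
      have h1 : ∀ a, (r a • h a) ▷ V ≫ ev V = (tpowAssoc V n).hom ≫ e' a ≫ e a ≫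
          (tpowAssoc V n).inv ≫ fromDual (tpow V n) x ▷ V ≫ ev V := by
        intro a
        rw [← hr', MonoidalLinear.smul_whiskerRight, Linear.smul_comp, ofPairing_evaluation]
        simp
      rw [sum_whiskerRight, Preadditive.sum_comp]
      simp only [h1]
      rw [← Preadditive.comp_sum, he', Iso.hom_inv_id_assoc]
    conv_rhs => rw [← hx, ← hsum]
    rw [sum_whiskerRight, Preadditive.comp_sum]
    refine Finset.sum_congr rfl fun a _ => ?_
    rw [← Category.assoc, ← hr]
    simp [f, MonoidalLinear.smul_whiskerRight]
  change indicatorSucc k P V n • 𝟙 (𝟙_ C) = indicatorSucc k P (dual V) n • 𝟙 (𝟙_ C)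
  rw [indicatorSucc_smul_id k P V n e e' he, indicatorSucc_smul_id k P (dual V) n f f' hres]
  refine Finset.sum_congr rfl fun a _ => ?_
  calc
    _ = rightTrace P (g a ≫ h a) := by
      rw [rightTrace_dual, comp_whiskerRight, Category.assoc, ofPairing_evaluation]
      exact adjAInv_mapT_comp P _ _
    _ = leftTrace P (g a ≫ h a) := (hP _ _).symm
    _ = leftTrace P (intoDual (tpow V n) ((tpowAssoc (dual V) n).hom ≫ f' a) ≫
          fromDual (tpow V n) (f a)) := by
      have hf' : (tpowAssoc (dual V) n).hom ≫ f' a =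
          tpow (dual V) n ◁ g a ≫ ε_ (tpow V n) (tpow (dual V) n) := Iso.hom_inv_id_assoc _ _
      rw [hf', intoDual_whiskerLeft_evaluation,
        fromDual_coevaluation_whiskerRight]
    _ = _ := leftTrace_intoDual_fromDual P _ _

end IndicatorTheorem

/-- In a pivotal category, dual objects are two-sided duals. -/
lemma PivotalStructure.nonempty_exactPairing {C : Type u} [Category.{v} C] [MonoidalCategory C]
    [RightRigidCategory C] (P : PivotalStructure C) (V : C) :
    Nonempty (ExactPairing (dual V) V) :=
  ⟨exactPairingCongrRight (X := dual V) (Y' := dual (dual V)) (P.j.app V)⟩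

end

end FrobeniusSchur

theorem mainTheorem4 (k : Type w) [Field k] (C : Type u) [Category.{v} C] [Abelian C] [Linear k C]
    [MonoidalCategory C] [MonoidalPreadditive C] [MonoidalLinear k C]
    [FrobeniusSchur.IsSemisimpleMonoidalCat k C] [RightRigidCategory C]
    (P : FrobeniusSchur.PivotalStructure C) :
    (∀ (V : C) (n : ℕ),
      (∃ X : C, Nonempty (ExactPairing X (FrobeniusSchur.tpow V n))) ∧
      Nonempty (FrobeniusSchur.IsotypicalComponent k (𝟙_ C) (FrobeniusSchur.tpow V (n + 1))) ∧
      ∀ (X : C) [ExactPairing X (FrobeniusSchur.tpow V n)]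
        (T : FrobeniusSchur.IsotypicalComponent k (𝟙_ C) (FrobeniusSchur.tpow V (n + 1))),
        FrobeniusSchur.leftTrace P (FrobeniusSchur.fsEndSucc k V n X T) =
          FrobeniusSchur.indicatorSucc k P V n • 𝟙 (𝟙_ C)) ∧
    (FrobeniusSchur.IsSpherical P → ∀ (V : C) (n : ℕ),
      FrobeniusSchur.indicatorSucc k P V n =
        FrobeniusSchur.indicatorSucc k P (FrobeniusSchur.dual V) n) :=
  ⟨fun V n => ⟨⟨_, P.nonempty_exactPairing _⟩, FrobeniusSchur.nonempty_isotypicalComponent k _ _,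
    fun X _ T => FrobeniusSchur.leftTrace_fsEndSucc k P V n X T⟩,
    fun hP V n => FrobeniusSchur.indicatorSucc_dual k P hP V n⟩
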